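/- Let $(R,\mathfrak m,k)$ be a complete Noetherian Cohen--Macaulay local ring. Let $\mathrm{CM}(R)$ be the category of maximal Cohen--Macaulay (MCM) $R$-modules, that is, finitely generated $R$-modules $M$ with $\mathrm{Ext}^i_R(k,M)=0$ for all $i<\dim R$, and let $\underline{\mathrm{CM}}(R)$ be its stable category, with the same objects and with $\underline{\mathrm{Hom}}_R(M,N)=\mathrm{Hom}_R(M,N)/\{\text{maps factoring through a finitely generated free module}\}$. Let $\mathrm{mod}\,\underline{\mathrm{CM}}(R)$ be the category of finitely presented contravariant additive functors from $\underline{\mathrm{CM}}(R)$ to abelian groups, i.e. those $F$ with an exact sequence $\underline{\mathrm{Hom}}_R(-,B)\to\underline{\mathrm{Hom}}_R(-,A)\to F\to 0$, $A,B\in \mathrm{CM}(R)$. Let $\mathsf{Sp}\,\mathrm{CM}(R)$ be the set of isomorphism classes of indecomposable (nonzero) MCM modules not isomorphic to $R$. For $\mathcal X\subseteq \mathsf{Sp}\,\mathrm{CM}(R)$ put $\Sigma(\mathcal X)=\{F\in\mathrm{mod}\,\underline{\mathrm{CM}}(R) : F(X)=0 \text{ for all } X\in\mathcal X\}$, and for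 a class $\mathcal F$ of objects of $\mathrm{mod}\,\underline{\mathrm{CM}}(R)$ put $\gamma(\mathcal F)=\{M\in \mathsf{Sp}\,\mathrm{CM}(R) : F(M)=0\text{ for all }F\in\mathcal F\}$. The sets $\mathcal X$ with $\gamma(\Sigma(\mathcal X))=\mathcal X$ are the closed sets of a topology on $\mathsf{Sp}\,\mathrm{CM}(R)$; equip $\mathsf{Sp}\,\mathrm{CM}(R)$ with it. Let $M\in\mathsf{Sp}\,\mathrm{CM}(R)$. Then $M$ is an isolated point, i.e. $\{M\}$ is open, if and only if there is an Auslander--Reiten sequence ending in $M$, that is, a non-split short exact sequence $0\to N\to E\xrightarrow{p} M\to 0$ of MCM modules with $N$ indecomposable, such that every homomorphism $q:L\to M$ with $L$ MCM which is not a split epimorphism factors through $p$. -/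

import Mathlib

universe u
open CategoryTheory CategoryTheory.Limits IsLocalRing Opposite

namespace MCM

section
variable (R : Type u) [CommRing R] [IsLocalRing R]

/-- Maximal Cohen-Macaulay modules: finitely generated modules `M` with `Ext^i(k, M) = 0` for all
`i < dim R`, where `k` is the residue field. -/
def IsMCM : ObjectProperty (ModuleCat.{u} R) := fun M =>
  Module.Finite R M ∧ ∀ i : ℕ, (i : WithBot ℕ∞) < ringKrullDim R →
    Subsingleton (Abelian.Ext (ModuleCat.of R (ResidueField R)) M i)

/-- The local ring `R` is Cohen-Macaulay: `R` is maximal Cohen-Macaulay over itself. -/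
class IsCohenMacaulay : Prop where
  isMCM_self : IsMCM R (ModuleCat.of R R)

/-- The full subcategory of maximal Cohen-Macaulay modules. -/
abbrev CM := (IsMCM R).FullSubcategory

/-- Two morphisms are identified when their difference factors through a free module. -/
def stableRel : HomRel (CM R) := fun M N f g =>
  ∃ (P : ModuleCat.{u} R) (_ : Module.Finite R P) (_ : Module.Free R P)
    (a : M.obj ⟶ P) (b : P ⟶ N.obj), f.hom - g.hom = a ≫ b

variable {R} in
theorem stableRel_add ⦃M N : CM R⦄ (f₁ f₂ g₁ g₂ : M ⟶ N) (hf : stableRel R f₁ f₂)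
    (hg : stableRel R g₁ g₂) : stableRel R (f₁ + g₁) (f₂ + g₂) := by
  obtain ⟨P, _, _, a, b, h⟩ := hf
  obtain ⟨Q, _, _, c, d, k⟩ := hg
  refine ⟨ModuleCat.of R (P × Q), inferInstanceAs (Module.Finite R (P × Q)),
    inferInstanceAs (Module.Free R (P × Q)), ModuleCat.ofHom (a.hom.prod c.hom),
    ModuleCat.ofHom (b.hom.coprod d.hom), ?_⟩
  have : (f₁ + g₁).hom - (f₂ + g₂).hom = (f₁.hom - f₂.hom) + (g₁.hom - g₂.hom) := by
    change f₁.hom + g₁.hom - (f₂.hom + g₂.hom) = _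
    abel
  rw [this, h, k]
  ext x
  simp

instance : Congruence (stableRel R) where
  comp_left f _ _ h := by
    obtain ⟨P, _, _, a, b, h⟩ := h
    refine ⟨P, ‹_›, ‹_›, f.hom ≫ a, b, ?_⟩
    rw [Category.assoc, ← h, Preadditive.comp_sub]
    rfl
  comp_right g h := by
    obtain ⟨P, _, _, a, b, h⟩ := h
    refine ⟨P, ‹_›, ‹_›, a, b ≫ g.hom, ?_⟩
    rw [← Category.assoc, ← h, Preadditive.sub_comp]
    rfl
  equivalence :=
    { refl f := ⟨ModuleCat.of R PUnit.{u+1}, inferInstanceAs (Module.Finite R PUnit.{u+1}),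
        inferInstanceAs (Module.Free R PUnit.{u+1}), 0, 0, by simp⟩
      symm := by
        rintro f g ⟨P, _, _, a, b, h⟩
        exact ⟨P, ‹_›, ‹_›, a, -b, by rw [Preadditive.comp_neg, ← h, neg_sub]⟩
      trans := by
        intro f g h hfg hgh
        obtain ⟨P, i, j, a, b, e⟩ := stableRel_add _ _ _ _ hfg hgh
        refine ⟨P, i, j, a, b, ?_⟩
        rw [← e]
        change f.hom - h.hom = f.hom + g.hom - (g.hom + h.hom)
        abel }

/-- The stable category of `CM R`. -/
abbrev StableCM := CategoryTheory.Quotient (stableRel R)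

noncomputable instance : Preadditive (StableCM R) :=
  CategoryTheory.Quotient.preadditive _ stableRel_add

/-- The projection `CM R ⥤ StableCM R`. -/
def stableFunctor : CM R ⥤ StableCM R := CategoryTheory.Quotient.functor (stableRel R)

/-- Finitely presented contravariant additive functors `F` on the stable category: there is an
exact sequence `Hom(-, B) ⟶ Hom(-, A) ⟶ F ⟶ 0` (exactness of functors is pointwise). -/
def IsFinPres : ObjectProperty ((StableCM R)ᵒᵖ ⥤ AddCommGrpCat.{u}) := fun F =>
  F.Additive ∧ ∃ (B A : StableCM R) (f : B ⟶ A) (π : preadditiveYoneda.obj A ⟶ F),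
    ∀ X : (StableCM R)ᵒᵖ, Function.Exact ((preadditiveYoneda.map f).app X) (π.app X) ∧
      Function.Surjective (π.app X)

/-- The category of finitely presented functors on the stable category. -/
abbrev ModStable := (IsFinPres R).FullSubcategory

/-- Indecomposable (in particular nonzero) maximal Cohen-Macaulay modules not isomorphic to `R`. -/
structure IndecCM where
  toCM : CM R
  indecomposable : Indecomposable toCM.obj
  not_iso_self : IsEmpty (toCM.obj ≅ ModuleCat.of R R)

/-- Isomorphism of `R`-modules. -/
instance isoSetoid : Setoid (IndecCM R) where
  r M N := Nonempty (M.1.obj ≅ N.1.obj)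
  iseqv := ⟨fun _ => ⟨Iso.refl _⟩, fun ⟨e⟩ => ⟨e.symm⟩, fun ⟨e⟩ ⟨f⟩ => ⟨e ≪≫ f⟩⟩

/-- The set of isomorphism classes of indecomposable maximal Cohen-Macaulay modules other than
`R`. -/
def Sp := _root_.Quotient (isoSetoid R)

variable {R}

/-- The isomorphism class of a module. -/
def Sp.mk (M : IndecCM R) : Sp R := Quotient.mk (isoSetoid R) M

theorem isZero_congr (F : ModStable R) {M N : IndecCM R} (e : M ≈ N) :
    IsZero (F.obj.obj (op ((stableFunctor R).obj M.1))) =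
      IsZero (F.obj.obj (op ((stableFunctor R).obj N.1))) := by
  obtain ⟨e⟩ := e
  exact propext (Iso.isZero_iff (F.obj.mapIso ((stableFunctor R).mapIso
    ((IsMCM R).isoMk e)).op).symm)

/-- `F(M) = 0`, for the isomorphism class `x` of `M`. -/
def Vanishes (F : ModStable R) (x : Sp R) : Prop :=
  _root_.Quotient.liftOn x (fun M => IsZero (F.obj.obj (op ((stableFunctor R).obj M.1))))
    fun _ _ e => isZero_congr F e

/-- `Σ(X)`: the functors that vanish on `X`. -/
def sigma (X : Set (Sp R)) : Set (ModStable R) := {F | ∀ x ∈ X, Vanishes F x}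

/-- `γ(𝓕)`: the points at which all functors in `𝓕` vanish. -/
def gamma (𝓕 : Set (ModStable R)) : Set (Sp R) := {x | ∀ F ∈ 𝓕, Vanishes F x}

theorem isMCM_of_iso {M N : ModuleCat.{u} R} (e : M ≅ N) (h : IsMCM R M) : IsMCM R N := by
  refine ⟨?_, fun i hi => ?_⟩
  · have := h.1
    exact Module.Finite.equiv e.toLinearEquiv
  · have := h.2 i hi
    refine ⟨fun x y => ?_⟩
    have key : ∀ z : Abelian.Ext (ModuleCat.of R (ResidueField R)) N i, z = 0 := fun z => by
      have h1 : z.comp (Abelian.Ext.mk₀ e.inv) (add_zero i) = 0 := Subsingleton.elim _ _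
      have h2 := congrArg (fun w => w.comp (Abelian.Ext.mk₀ e.hom) (add_zero i)) h1
      simpa using h2
    rw [key x, key y]

theorem isMCM_X₁ [IsNoetherianRing R] {S : ShortComplex (ModuleCat.{u} R)} (hS : S.ShortExact)
    (h₂ : IsMCM R S.X₂) (h₃ : IsMCM R S.X₃) : IsMCM R S.X₁ := by
  refine ⟨?_, fun i hi => ?_⟩
  · have := h₂.1
    exact Module.Finite.of_injective S.f.hom hS.moduleCat_injective_f
  · have := h₂.2 i hi
    suffices key : ∀ z : Abelian.Ext (ModuleCat.of R (ResidueField R)) S.X₁ i, z = 0 from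
      ⟨fun x y => by rw [key x, key y]⟩
    intro z
    cases i with
    | zero =>
      have := hS.mono_f
      apply Abelian.Ext.postcomp_mk₀_injective_of_mono _ S.f
      exact Subsingleton.elim _ _
    | succ j =>
      obtain ⟨w, rfl⟩ := Abelian.Ext.covariant_sequence_exact₁ _ hS z (Subsingleton.elim _ _) rfl
      have := h₃.2 j (lt_trans (by exact_mod_cast Nat.lt_succ_self j) hi)
      rw [Subsingleton.elim w 0, Abelian.Ext.zero_comp]

theorem isMCM_X₂ {S : ShortComplex (ModuleCat.{u} R)} (hS : S.ShortExact)
    (h₁ : IsMCM R S.X₁) (h₃ : IsMCM R S.X₃) : IsMCM R S.X₂ := by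
  refine ⟨?_, fun i hi => ?_⟩
  · have := h₁.1
    have := h₃.1
    exact Module.Finite.of_exact (f := S.f.hom) (g := S.g.hom) 
      ((ShortComplex.ShortExact.moduleCat_exact_iff_function_exact S).1 hS.exact)
      hS.moduleCat_surjective_g
  · have := h₁.2 i hi
    have := h₃.2 i hi
    suffices key : ∀ z : Abelian.Ext (ModuleCat.of R (ResidueField R)) S.X₂ i, z = 0 from
      ⟨fun x y => by rw [key x, key y]⟩
    intro z
    obtain ⟨w, rfl⟩ := Abelian.Ext.covariant_sequence_exact₂ _ hS z (Subsingleton.elim _ _)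
    rw [Subsingleton.elim w 0, Abelian.Ext.zero_comp]

theorem isMCM_prod (M N : ModuleCat.{u} R) (hM : IsMCM R M) (hN : IsMCM R N) :
    IsMCM R (ModuleCat.of R (M × N)) :=
  isMCM_X₂ (S := ModuleCat.shortComplexOfCompEqZero (LinearMap.inl R M N) (LinearMap.snd R M N)
    (by ext; simp))
    (ModuleCat.shortComplex_shortExact _ Function.Exact.inl_snd LinearMap.inl_injective
      LinearMap.snd_surjective) hM hN

theorem isMCM_pi [IsCohenMacaulay R] (n : ℕ) : IsMCM R (ModuleCat.of R (Fin n → R)) := by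
  induction n with
  | zero =>
    refine ⟨inferInstanceAs (Module.Finite R (Fin 0 → R)), fun i _ => ?_⟩
    have : IsZero (ModuleCat.of R (Fin 0 → R)) := ModuleCat.isZero_of_subsingleton _
    refine ⟨fun x y => ?_⟩
    rw [← Abelian.Ext.comp_mk₀_id x, ← Abelian.Ext.comp_mk₀_id y, this.eq_of_src (𝟙 _) 0]
    simp
  | succ n ih =>
    exact isMCM_of_iso (Fin.consLinearEquiv R (fun _ : Fin (n + 1) => R)).toModuleIso
      (isMCM_prod _ _ IsCohenMacaulay.isMCM_self ih)

theorem isMCM_ker [IsNoetherianRing R] {M N : ModuleCat.{u} R} (φ : M →ₗ[R] N) (hφ : Function.Surjective φ)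
    (hM : IsMCM R M) (hN : IsMCM R N) : IsMCM R (ModuleCat.of R (LinearMap.ker φ)) :=
  isMCM_X₁ (LinearMap.shortExact_shortComplexKer hφ) hM hN

end
section
variable {R : Type u} [CommRing R]

theorem isPrecomplete_of_finite (I : Ideal R) [IsPrecomplete I R] (M : Type u) [AddCommGroup M]
    [Module R M] [Module.Finite R M] : IsPrecomplete I M := by
  rw [← AdicCompletion.of_surjective_iff]
  intro y
  obtain ⟨t, rfl⟩ := AdicCompletion.ofTensorProduct_surjective_of_finite I M y
  induction t using TensorProduct.induction_on with
  | zero => exact ⟨0, by simp⟩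
  | tmul r x =>
    obtain ⟨s, rfl⟩ := AdicCompletion.of_surjective I R r
    refine ⟨s • x, ?_⟩
    rw [AdicCompletion.ofTensorProduct_tmul, map_smul]
    ext n
    rfl
  | add a b ha hb =>
    obtain ⟨a', ha⟩ := ha
    obtain ⟨b', hb⟩ := hb
    exact ⟨a' + b', by rw [map_add, map_add, ha, hb]⟩

theorem exists_idempotent_of_finite [IsNoetherianRing R] [IsLocalRing R]
    [IsAdicComplete (maximalIdeal R) R] {A : Type u} [CommRing A] [Algebra R A] [Module.Finite R A]
    (x : A) : ∃ e : A, e * e = e ∧ (e = 0 → IsUnit (1 - x)) ∧ (e = 1 → IsUnit x) := by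
  let J : Ideal A := (maximalIdeal R).map (algebraMap R A)
  have : IsPrecomplete (maximalIdeal R) A := isPrecomplete_of_finite _ _
  have : IsPrecomplete J A := IsPrecomplete.map_algebraMap_iff.2 ‹_›
  have : IsHausdorff J A := IsHausdorff.map_algebraMap_iff.2 inferInstance
  have : IsAdicComplete J A := ⟨⟩
  have hJ := IsAdicComplete.le_jacobson_bot (R := A) J
  have hloc : IsLocalHom (Ideal.Quotient.mk J) := isLocalHom_of_le_jacobson_bot J hJ
  have hart : IsArtinianRing (A ⧸ J) := by
    let : Algebra (R ⧸ maximalIdeal R) (A ⧸ J) :=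
      Ideal.Quotient.algebraQuotientOfLEComap Ideal.le_comap_map
    have : IsScalarTower R (R ⧸ maximalIdeal R) (A ⧸ J) :=
      IsScalarTower.of_algebraMap_eq fun _ => rfl
    have : Module.Finite (R ⧸ maximalIdeal R) (A ⧸ J) :=
      Module.Finite.of_restrictScalars_finite R _ _
    let : Field (R ⧸ maximalIdeal R) := Ideal.Quotient.field _
    exact IsArtinianRing.of_finite (R ⧸ maximalIdeal R) _
  obtain ⟨n, hn⟩ := IsArtinian.range_smul_pow_stabilizes (R := A ⧸ J) (A ⧸ J)
    (Ideal.Quotient.mk J x)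
  obtain ⟨y, hy⟩ : ∃ y : A, Ideal.Quotient.mk J (x ^ (n + 1)) =
      Ideal.Quotient.mk J (x ^ (n + 1) * x ^ (n + 1) * y) := by
    have h1 := (hn (n + 1) (by omega)).symm.trans (hn (2 * n + 2) (by omega))
    have h2 : (Ideal.Quotient.mk J x) ^ (n + 1) ∈
        LinearMap.range ((Ideal.Quotient.mk J x) ^ (n + 1) •
          (LinearMap.id : A ⧸ J →ₗ[A ⧸ J] A ⧸ J)) := ⟨1, by simp⟩
    rw [h1] at h2
    obtain ⟨z, hz⟩ := h2
    obtain ⟨y, rfl⟩ := Ideal.Quotient.mk_surjective z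
    refine ⟨y, ?_⟩
    rw [map_mul, map_mul, map_pow, ← pow_add, ← two_mul, mul_add, ← smul_eq_mul]
    exact hz.symm
  let a := x ^ (n + 1) * y
  have ha : Ideal.Quotient.mk J (a * a) = Ideal.Quotient.mk J a := by
    simp only [a]
    rw [show x ^ (n + 1) * y * (x ^ (n + 1) * y) = x ^ (n + 1) * x ^ (n + 1) * y * y by ring,
      map_mul, ← hy, ← map_mul]
  obtain ⟨e, he, hea⟩ := HenselianRing.is_henselian (R := A) (I := J)
    (Polynomial.X ^ 2 - Polynomial.X) (by monicity!) a
    (by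
      rw [Polynomial.eval_sub, Polynomial.eval_pow, Polynomial.eval_X, pow_two]
      exact Ideal.Quotient.eq.1 ha)
    (by
      apply IsUnit.of_mul_eq_one (Ideal.Quotient.mk J (2 * a - 1))
      simp only [map_mul, map_sub, map_one, map_ofNat] at ha ⊢
      simp
      linear_combination 4 * ha)
  have hea' := Ideal.Quotient.eq.2 hea
  refine ⟨e, ?_, fun h => ?_, fun h => ?_⟩
  · simp [pow_two, sub_eq_zero] at he
    exact he
  · have : Ideal.Quotient.mk J x ^ (n + 1) = 0 := by
      rw [← map_pow, hy, mul_assoc, map_mul]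
      change _ * Ideal.Quotient.mk J a = 0
      rw [← hea', h, map_zero, mul_zero]
    apply hloc.map_nonunit
    rw [map_sub, map_one]
    exact IsNilpotent.isUnit_one_sub ⟨_, this⟩
  · apply hloc.map_nonunit
    rw [h] at hea'
    apply IsUnit.of_mul_eq_one (Ideal.Quotient.mk J (x ^ n * y))
    rw [← map_mul, ← map_one (Ideal.Quotient.mk J), hea']
    simp only [a]
    congr 1
    ring

theorem isLocalRing_end [IsNoetherianRing R] [IsLocalRing R] [IsAdicComplete (maximalIdeal R) R]
    (M : Type u) [AddCommGroup M] [Module R M] [Module.Finite R M] [Nontrivial M]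
    (hM : ∀ e : Module.End R M, e * e = e → e = 0 ∨ e = 1) : IsLocalRing (Module.End R M) := by
  refine ⟨fun {φ b} h => ?_⟩
  obtain rfl : b = 1 - φ := by rw [← h]; abel
  let ψ : Polynomial R →ₐ[R] Module.End R M := Polynomial.aeval φ
  let ι := Ideal.kerLiftAlg ψ
  have hι : Function.Injective ι := Ideal.kerLiftAlg_injective _
  have : Module.Finite R (Polynomial R ⧸ RingHom.ker ψ) :=
    Module.Finite.of_injective ι.toLinearMap hι
  have hx : ι (Ideal.Quotient.mk _ Polynomial.X) = φ := by
    rw [Ideal.kerLiftAlg_mk]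
    exact Polynomial.aeval_X φ
  obtain ⟨e, he, h0, h1⟩ := exists_idempotent_of_finite (R := R)
    (Ideal.Quotient.mk (RingHom.ker ψ) Polynomial.X)
  rcases hM (ι e) (by rw [← map_mul, he]) with h | h
  · right
    have := (h0 (hι (by rw [h, map_zero]))).map ι
    rwa [map_sub, map_one, hx] at this
  · left
    have := (h1 (hι (by rw [h, map_one]))).map ι
    rwa [hx] at this
end

section
variable {R : Type u} [CommRing R] [IsLocalRing R]

theorem not_isZero (M : IndecCM R) : Nontrivial M.1.obj := by
  by_contra h
  rw [not_nontrivial_iff_subsingleton] at h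
  exact M.2.1 (ModuleCat.isZero_of_subsingleton _)

theorem subsingleton_or (M : IndecCM R) {Y Z : Type u} [AddCommGroup Y] [Module R Y]
    [AddCommGroup Z] [Module R Z] (e : M.1.obj ≃ₗ[R] (Y × Z)) : Subsingleton Y ∨ Subsingleton Z := by
  have := M.2.2 (ModuleCat.of R Y) (ModuleCat.of R Z)
    (e.toModuleIso ≪≫ (ModuleCat.biprodIsoProd (ModuleCat.of R Y) (ModuleCat.of R Z)).symm)
  exact this.imp (fun h => ModuleCat.subsingleton_of_isZero h) fun h => ModuleCat.subsingleton_of_isZero h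

theorem isLocalRing_end_indec [IsNoetherianRing R] [IsAdicComplete (maximalIdeal R) R] (M : IndecCM R) :
    IsLocalRing (Module.End R M.1.obj) := by
  have := not_isZero M
  have := M.1.property.1
  apply isLocalRing_end
  intro e he
  have hc := LinearMap.IsIdempotentElem.isCompl (f := e) he
  rcases subsingleton_or M (Submodule.prodEquivOfIsCompl _ _ hc).symm with h | h
  · left
    exact LinearMap.range_eq_bot.1 ((Submodule.subsingleton_iff_eq_bot).1 h)
  · right
    have hk := (Submodule.subsingleton_iff_eq_bot).1 h
    ext x
    have : e x - x ∈ LinearMap.ker e := by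
      rw [LinearMap.mem_ker, map_sub, sub_eq_zero]
      exact congrArg (fun g : Module.End R M.1.obj => g x) he
    rw [hk] at this
    exact sub_eq_zero.1 this

theorem not_retract_of_free [IsNoetherianRing R] (M : IndecCM R) (P : ModuleCat.{u} R) [Module.Finite R P]
    [Module.Free R P] (a : M.1.obj ⟶ P) (b : P ⟶ M.1.obj) (h : a ≫ b = 𝟙 _) : False := by
  have hab : b.hom ∘ₗ a.hom = LinearMap.id := by rw [← ModuleCat.hom_comp, h]; rfl
  have := M.1.property.1
  have : Module.Projective R M.1.obj := Module.Projective.of_split a.hom b.hom hab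
  have : Module.Free R M.1.obj := Module.free_of_flat_of_isLocalRing
  have e := (Module.finBasis R M.1.obj).equivFun
  generalize Module.finrank R M.1.obj = n at e
  cases n with
  | zero =>
    have := not_isZero M
    have := e.symm.toEquiv.nontrivial
    exact not_subsingleton (Fin 0 → R) inferInstance
  | succ n =>
    rcases subsingleton_or M (e.trans (Fin.consLinearEquiv R (fun _ : Fin (n + 1) => R)).symm) with h | h
    · exact not_subsingleton R h
    · cases n with
      | zero =>
        exact M.3.false (e.trans (LinearEquiv.funUnique (Fin 1) R R)).toModuleIso
      | succ n => exact not_subsingleton (Fin (n + 1) → R) h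

theorem exact_cokernel {B A : StableCM R} (f : B ⟶ A) (X : (StableCM R)ᵒᵖ) :
    Function.Exact ((preadditiveYoneda.map f).app X)
      ((cokernel.π (preadditiveYoneda.map f)).app X) ∧
    Function.Surjective ((cokernel.π (preadditiveYoneda.map f)).app X) := by
  constructor
  · have h := ShortComplex.exact_cokernel (preadditiveYoneda.map f)
    have h' := h.map ((evaluation _ _).obj X)
    exact (ShortComplex.ab_exact_iff_function_exact _).1 h'
  · rw [← AddCommGrpCat.epi_iff_surjective]
    infer_instance

theorem isFinPres_cokernel {B A : StableCM R} (f : B ⟶ A) :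
    IsFinPres R (cokernel (preadditiveYoneda.map f)) := by
  refine ⟨⟨fun {X Y g h} => ?_⟩, B, A, f, cokernel.π _, exact_cokernel f⟩
  have := (exact_cokernel f X).2
  ext x
  obtain ⟨x, rfl⟩ := this x
  have nat : ∀ k : X ⟶ Y, (cokernel (preadditiveYoneda.map f)).map k
      ((cokernel.π (preadditiveYoneda.map f)).app X x) =
      (cokernel.π (preadditiveYoneda.map f)).app Y ((preadditiveYoneda.obj A).map k x) :=
    fun k => (NatTrans.naturality_apply (cokernel.π (preadditiveYoneda.map f)) k x).symm
  rw [AddCommGrpCat.hom_add_apply]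
  rw [nat, nat, nat, Functor.map_add, ← map_add]
  rfl

theorem map_stable_eq_iff {M N : CM R} (f g : M ⟶ N) :
    (stableFunctor R).map f = (stableFunctor R).map g ↔ stableRel R f g :=
  CategoryTheory.Quotient.functor_map_eq_iff _ _ _

theorem map_stable_surjective {M N : CM R} (f : (stableFunctor R).obj M ⟶ (stableFunctor R).obj N) :
    ∃ g : M ⟶ N, (stableFunctor R).map g = f :=
  (CategoryTheory.Quotient.functor (stableRel R)).map_surjective f

theorem vanishes_mk (F : ModStable R) (M : IndecCM R) : Vanishes F (Sp.mk M) ↔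
    ∀ y : F.obj.obj (op ((stableFunctor R).obj M.1)), y = 0 := by
  change IsZero _ ↔ _
  rw [AddCommGrpCat.isZero_iff_subsingleton]
  exact ⟨fun _ y => Subsingleton.elim _ _, fun h => ⟨fun x y => by rw [h x, h y]⟩⟩

theorem exists_map_of_notMem_closure [IsNoetherianRing R] [IsCohenMacaulay R] (X : Set (Sp R)) (M : IndecCM R)
    (h : Sp.mk M ∉ gamma (sigma X)) :
    ∃ (K : CM R) (p : K ⟶ M.1), (∀ N : IndecCM R, Sp.mk N ∈ X → ∀ h : N.1 ⟶ M.1,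
      ∃ u : N.1 ⟶ K, u ≫ p = h) ∧ ∀ u : M.1 ⟶ K, u ≫ p ≠ 𝟙 _ := by
  simp only [gamma, Set.mem_ofPred_eq, not_forall] at h
  obtain ⟨F, hF, hFM⟩ := h
  obtain ⟨hadd, B, A, f, π, hπ⟩ := F.property
  obtain ⟨B, rfl⟩ : ∃ B', B = (stableFunctor R).obj B' := ⟨B.as, rfl⟩
  obtain ⟨A, rfl⟩ : ∃ A', A = (stableFunctor R).obj A' := ⟨A.as, rfl⟩
  obtain ⟨β, rfl⟩ := map_stable_surjective f
  rw [vanishes_mk, not_forall] at hFM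
  obtain ⟨y, hy⟩ := hFM
  obtain ⟨a, rfl⟩ := (hπ _).2 y
  obtain ⟨a, rfl⟩ : ∃ a' : M.1 ⟶ A, (stableFunctor R).map a' = a := map_stable_surjective a
  have := A.property.1
  obtain ⟨n, θ, hθ⟩ := Module.Finite.exists_fin' R A.obj
  let φ : ((M.1.obj × B.obj) × (Fin n → R)) →ₗ[R] A.obj :=
    (a.hom.hom.coprod (-β.hom.hom)).coprod (-θ)
  have hφ : Function.Surjective φ := fun x => by
    obtain ⟨z, rfl⟩ := hθ x
    exact ⟨((0, 0), -z), by simp [φ]⟩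
  let K : CM R := ⟨ModuleCat.of R (LinearMap.ker φ),
    isMCM_ker (M := ModuleCat.of R ((M.1.obj × B.obj) × (Fin n → R))) φ hφ
      (isMCM_prod (ModuleCat.of R (M.1.obj × B.obj)) _
        (isMCM_prod _ _ M.1.property B.property) (isMCM_pi n)) A.property⟩
  let p : K ⟶ M.1 := ObjectProperty.homMk (ModuleCat.ofHom
    (LinearMap.fst R _ _ ∘ₗ LinearMap.fst R _ _ ∘ₗ (LinearMap.ker φ).subtype))
  refine ⟨K, p, fun N hN h => ?_, fun u hu => hy ?_⟩
  · have h0 := (vanishes_mk F N).1 (hF _ hN)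
    obtain ⟨b, hb⟩ := ((hπ (op ((stableFunctor R).obj N.1))).1 ((stableFunctor R).map (h ≫ a))).1 (h0 _)
    obtain ⟨b, rfl⟩ : ∃ b' : N.1 ⟶ B, (stableFunctor R).map b' = b := map_stable_surjective b
    have hb' : (stableFunctor R).map (h ≫ a) = (stableFunctor R).map (b ≫ β) := by
      rw [← hb, Functor.map_comp]
      rfl
    rw [map_stable_eq_iff] at hb'
    obtain ⟨P, _, _, c, d, hcd⟩ := hb'
    obtain ⟨l, hl⟩ := Module.projective_lifting_property θ d.hom hθ
    have key : ∀ x, a.hom (h.hom x) - β.hom (b.hom x) = θ (l (c.hom x)) := fun x => by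
      have h1 := congrArg (fun g => ModuleCat.Hom.hom g x) hcd
      have h2 := congrArg (fun g => g (c.hom x)) hl
      exact h1.trans h2.symm
    refine ⟨ObjectProperty.homMk (ModuleCat.ofHom (LinearMap.codRestrict (LinearMap.ker φ)
      ((h.hom.hom.prod b.hom.hom).prod (l ∘ₗ c.hom)) fun x => ?_)), ?_⟩
    · change a.hom.hom (h.hom.hom x) + -β.hom.hom (b.hom.hom x) + -θ (l (c.hom x)) = 0
      rw [← key x]
      change a.hom.hom (h.hom.hom x) + -β.hom.hom (b.hom.hom x) +
        -(a.hom.hom (h.hom.hom x) - β.hom.hom (b.hom.hom x)) = 0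
      abel
    · ext x
      rfl
  · let b : M.1 ⟶ B := ObjectProperty.homMk (ModuleCat.ofHom
      (LinearMap.snd R _ _ ∘ₗ LinearMap.fst R _ _ ∘ₗ (LinearMap.ker φ).subtype ∘ₗ u.hom.hom))
    have hab : (stableFunctor R).map a = (stableFunctor R).map (b ≫ β) := by
      rw [map_stable_eq_iff]
      refine ⟨ModuleCat.of R (Fin n → R), inferInstanceAs (Module.Finite R (Fin n → R)),
        inferInstanceAs (Module.Free R (Fin n → R)), ModuleCat.ofHom
        (LinearMap.snd R _ _ ∘ₗ (LinearMap.ker φ).subtype ∘ₗ u.hom.hom), ModuleCat.ofHom θ, ?_⟩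
      ext x
      have h1 : φ (u.hom.hom x).1 = 0 := (u.hom.hom x).2
      have h2 : (u.hom.hom x).1.1.1 = x := congrArg (fun g => ModuleCat.Hom.hom g.hom x) hu
      simp only [φ, LinearMap.coprod_apply, LinearMap.neg_apply, h2] at h1
      change a.hom.hom x - β.hom.hom ((u.hom.hom x).1.1.2) = θ (u.hom.hom x).1.2
      rw [← sub_eq_zero, ← h1]
      abel
    rw [hab, Functor.map_comp]
    exact ((hπ _).1 _).2 ⟨(stableFunctor R).map b, rfl⟩

theorem notMem_closure_of_map [IsNoetherianRing R] [IsAdicComplete (maximalIdeal R) R]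
    (X : Set (Sp R)) (M : IndecCM R) (K : CM R) (p : K ⟶ M.1)
    (hp : ∀ N : IndecCM R, Sp.mk N ∈ X → ∀ h : N.1 ⟶ M.1, ∃ u : N.1 ⟶ K, u ≫ p = h)
    (hM : ∀ u : M.1 ⟶ K, u ≫ p ≠ 𝟙 _) : Sp.mk M ∉ gamma (sigma X) := by
  have := isLocalRing_end_indec M
  let F : ModStable R := ⟨_, isFinPres_cokernel ((stableFunctor R).map p)⟩
  have hF := exact_cokernel ((stableFunctor R).map p)
  intro h
  have hFM : Vanishes F (Sp.mk M) := h F fun x hx => by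
    obtain ⟨N, rfl⟩ := Quotient.exists_rep x
    refine (vanishes_mk F N).2 fun y => ?_
    obtain ⟨y, rfl⟩ := (hF _).2 y
    obtain ⟨g, rfl⟩ : ∃ g : N.1 ⟶ M.1, (stableFunctor R).map g = y := map_stable_surjective y
    obtain ⟨u, rfl⟩ := hp N hx g
    rw [Functor.map_comp]
    exact ((hF _).1 _).2 ⟨(stableFunctor R).map u, rfl⟩
  rw [vanishes_mk] at hFM
  obtain ⟨u, hu⟩ := ((hF _).1 ((stableFunctor R).map (𝟙 M.1))).1 (hFM _)
  obtain ⟨u, rfl⟩ : ∃ g : M.1 ⟶ K, (stableFunctor R).map g = u := map_stable_surjective u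
  have hu' : (stableFunctor R).map (𝟙 M.1) = (stableFunctor R).map (u ≫ p) := by
    rw [← hu, Functor.map_comp]
    rfl
  rw [map_stable_eq_iff] at hu'
  obtain ⟨P, _, _, a, b, hab⟩ := hu'
  have h1 : (u ≫ p).hom.hom + (a ≫ b).hom = (1 : Module.End R M.1.obj) := by
    rw [← hab]
    ext x
    simp
  rcases IsLocalRing.isUnit_or_isUnit_of_add_one h1 with h | h
  · obtain ⟨v, hv⟩ := h.exists_right_inv
    apply hM (ObjectProperty.homMk (ModuleCat.ofHom v) ≫ u)
    ext x
    exact congrArg (fun g : Module.End R M.1.obj => g x) hv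
  · obtain ⟨v, hv⟩ := h.exists_right_inv
    apply not_retract_of_free M P (ModuleCat.ofHom v ≫ a) b
    ext x
    exact congrArg (fun g : Module.End R M.1.obj => g x) hv

theorem subset_closure (X : Set (Sp R)) : X ⊆ gamma (sigma X) := fun _ hx _ hF => hF _ hx

theorem closure_mono {X Y : Set (Sp R)} (h : X ⊆ Y) : gamma (sigma X) ⊆ gamma (sigma Y) :=
  fun _ hx F hF => hx F fun y hy => hF y (h hy)

theorem closure_empty [IsNoetherianRing R] [IsAdicComplete (maximalIdeal R) R] : gamma (sigma (∅ : Set (Sp R))) = ∅ := by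
  refine Set.eq_empty_of_forall_notMem fun x => ?_
  obtain ⟨M, rfl⟩ := Quotient.exists_rep x
  refine notMem_closure_of_map _ M M.1 0 (fun N hN => hN.elim) fun u hu => ?_
  rw [comp_zero] at hu
  exact M.2.1 ((IsZero.iff_id_eq_zero _).2 (congrArg (fun g => g.hom) hu).symm)

theorem closure_union [IsNoetherianRing R] [IsCohenMacaulay R] [IsAdicComplete (maximalIdeal R) R] (X Y : Set (Sp R)) :
    gamma (sigma (X ∪ Y)) = gamma (sigma X) ∪ gamma (sigma Y) := by
  refine Set.Subset.antisymm (fun x hx => ?_) (Set.union_subset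
    (closure_mono Set.subset_union_left) (closure_mono Set.subset_union_right))
  by_contra hxy
  rw [Set.mem_union, not_or] at hxy
  obtain ⟨M, rfl⟩ := Quotient.exists_rep x
  obtain ⟨K, p, hp, hpM⟩ := exists_map_of_notMem_closure X M hxy.1
  obtain ⟨L, q, hq, hqM⟩ := exists_map_of_notMem_closure Y M hxy.2
  refine notMem_closure_of_map (X ∪ Y) M ⟨_, isMCM_prod _ _ K.property L.property⟩
    (ObjectProperty.homMk (ModuleCat.ofHom (p.hom.hom.coprod q.hom.hom))) ?_ ?_ hx
  · rintro N (hN | hN) h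
    · obtain ⟨u, rfl⟩ := hp N hN h
      refine ⟨ObjectProperty.homMk (ModuleCat.ofHom (LinearMap.inl R _ _ ∘ₗ u.hom.hom)), ?_⟩
      ext x
      simp
    · obtain ⟨u, rfl⟩ := hq N hN h
      refine ⟨ObjectProperty.homMk (ModuleCat.ofHom (LinearMap.inr R _ _ ∘ₗ u.hom.hom)), ?_⟩
      ext x
      simp
  · intro u hu
    have := isLocalRing_end_indec M
    let u₁ : M.1.obj →ₗ[R] K.obj := LinearMap.fst R _ _ ∘ₗ u.hom.hom
    let u₂ : M.1.obj →ₗ[R] L.obj := LinearMap.snd R _ _ ∘ₗ u.hom.hom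
    have h1 : p.hom.hom ∘ₗ u₁ + q.hom.hom ∘ₗ u₂ = (1 : Module.End R M.1.obj) := by
      ext x
      exact congrArg (fun g => ModuleCat.Hom.hom g.hom x) hu
    rcases IsLocalRing.isUnit_or_isUnit_of_add_one h1 with h | h
    · obtain ⟨v, hv⟩ := h.exists_right_inv
      apply hpM (ObjectProperty.homMk (ModuleCat.ofHom (u₁ ∘ₗ v)))
      ext x
      exact congrArg (fun g : Module.End R M.1.obj => g x) hv
    · obtain ⟨v, hv⟩ := h.exists_right_inv
      apply hqM (ObjectProperty.homMk (ModuleCat.ofHom (u₂ ∘ₗ v)))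
      ext x
      exact congrArg (fun g : Module.End R M.1.obj => g x) hv

/-- The topology on `Sp CM(R)` whose closed sets are the sets `X` with `γ (Σ X) = X`. -/
instance zieglerTopology [IsNoetherianRing R] [IsCohenMacaulay R]
    [IsAdicComplete (maximalIdeal R) R] : TopologicalSpace (Sp R) :=
  TopologicalSpace.ofClosed {X | gamma (sigma X) = X} closure_empty
    (fun A hA => Set.Subset.antisymm
      (Set.subset_sInter fun X hX => (closure_mono (Set.sInter_subset_of_mem hX)).trans (hA hX).subset)
      (subset_closure _))
    fun X hX Y hY => by
      change gamma (sigma (X ∪ Y)) = X ∪ Y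
      rw [closure_union, hX, hY]

theorem isClosed_iff [IsNoetherianRing R] [IsCohenMacaulay R] [IsAdicComplete (maximalIdeal R) R] (X : Set (Sp R)) :
    IsClosed X ↔ gamma (sigma X) = X := by
  rw [← isOpen_compl_iff]
  change gamma (sigma Xᶜᶜ) = Xᶜᶜ ↔ _
  rw [compl_compl]
end

section
variable {R : Type u} [CommRing R] [IsLocalRing R]

/-- Auslander-Reiten sequences in `CM(R)`: non-split short exact sequences `0 → N → E → M → 0` of
maximal Cohen-Macaulay modules with `N` and `M` indecomposable, such that every morphism `L ⟶ M`
with `L` maximal Cohen-Macaulay that is not a split epimorphism factors through `E ⟶ M`. -/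
structure IsARSequence (S : ShortComplex (ModuleCat.{u} R)) : Prop where
  isMCM₁ : IsMCM R S.X₁
  isMCM₂ : IsMCM R S.X₂
  isMCM₃ : IsMCM R S.X₃
  indecomposable₁ : Indecomposable S.X₁
  indecomposable₃ : Indecomposable S.X₃
  shortExact : S.ShortExact
  nonsplit : IsEmpty S.Splitting
  exists_lift : ∀ (L : ModuleCat.{u} R) (q : L ⟶ S.X₃), IsMCM R L → ¬ IsSplitEpi q →
    ∃ h : L ⟶ S.X₂, h ≫ S.g = q
end

end MCM

/-! The point `M` is open iff it lies outside the closure of its complement. By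
`exists_map_of_notMem_closure` and `notMem_closure_of_map` this means that some `p : K ⟶ M` in `CM
R` has no section, while every map to `M` from an indecomposable non-free MCM module not isomorphic
to `M` lifts along `p`. The right-hand map of an Auslander-Reiten sequence is such a `p`.

Conversely, such a `p` is improved in three stages. Adding a free cover makes it surjective.
Choosing it with the largest possible set of endomorphisms of `M` that lift makes all non-surjective
endomorphisms lift (`exists_lift_indecomposable`). Both operations keep `p` non-split because `End
M` is local, a consequence of completeness, and `M` is not a retract of a free module. A map from an
arbitrary MCM module that fails to lift already fails on an indecomposable summand, so `p` is right
almost split (`exists_rightAlmostSplit`). Finally, the identity of `ker p` does not extend over the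
extension, so neither does some map from `ker p` to an indecomposable MCM module; pushing out along
that map gives the required kernel and keeps all lifts (`exists_nonsplit_indecomposable_kernel`). -/

namespace MCM

/-! ### Indecomposability and non-split maps. -/

section
variable {R : Type u} [CommRing R]

/-- A property of quotients of a Noetherian module which, for a product, passes to one of the
factors, and which fails for zero modules, is satisfied by an indecomposable quotient. -/
theorem exists_indecomposable_quotient (L : ModuleCat.{u} R) [IsNoetherian R L]
    (P : ∀ Y : ModuleCat.{u} R, (L →ₗ[R] Y) → Prop) (h₀ : P L LinearMap.id)
    (hsurj : ∀ Y a, P Y a → Function.Surjective a)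
    (hne : ∀ Y a, P Y a → ¬ Subsingleton Y)
    (hprod : ∀ Y a, P Y a → ∀ (Y₁ Y₂ : ModuleCat.{u} R) (e : Y ≃ₗ[R] (Y₁ × Y₂)),
      P Y₁ (LinearMap.fst R Y₁ Y₂ ∘ₗ e.toLinearMap ∘ₗ a) ∨
      P Y₂ (LinearMap.snd R Y₁ Y₂ ∘ₗ e.toLinearMap ∘ₗ a)) :
    ∃ Y a, P Y a ∧ Indecomposable Y := by
  -- Take a quotient with maximal kernel. Passing to a factor that keeps `P` cannot enlarge the
  -- kernel, so the other factor must vanish.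
  obtain ⟨W, ⟨Y, a, hP, rfl⟩, hmax⟩ := set_has_maximal_iff_noetherian.2 ‹IsNoetherian R L›
    {W | ∃ Y a, P Y a ∧ LinearMap.ker a = W} ⟨_, L, _, h₀, rfl⟩
  refine ⟨Y, a, hP, fun h => hne Y a hP (ModuleCat.subsingleton_of_isZero h), fun Y₁ Y₂ e => ?_⟩
  let e' : Y ≃ₗ[R] (Y₁ × Y₂) := (e ≪≫ ModuleCat.biprodIsoProd Y₁ Y₂).toLinearEquiv
  rcases hprod Y a hP Y₁ Y₂ e' with h | h
  · right
    have hle : LinearMap.ker a ≤ LinearMap.ker (LinearMap.fst R Y₁ Y₂ ∘ₗ e'.toLinearMap ∘ₗ a) :=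
      fun x hx => by simp [LinearMap.mem_ker.1 hx]
    have heq := eq_of_le_of_not_lt hle (hmax _ ⟨_, _, h, rfl⟩)
    refine (ModuleCat.isZero_iff_subsingleton).2 (subsingleton_of_forall_eq 0 fun y => ?_)
    obtain ⟨x, hx⟩ := hsurj Y a hP (e'.symm (0, y))
    have hx' : x ∈ LinearMap.ker a := by
      rw [heq, LinearMap.mem_ker]
      simp [hx]
    rw [LinearMap.mem_ker.1 hx'] at hx
    simpa using congrArg (fun z => (e' z).2) hx.symm
  · left
    have hle : LinearMap.ker a ≤ LinearMap.ker (LinearMap.snd R Y₁ Y₂ ∘ₗ e'.toLinearMap ∘ₗ a) :=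
      fun x hx => by simp [LinearMap.mem_ker.1 hx]
    have heq := eq_of_le_of_not_lt hle (hmax _ ⟨_, _, h, rfl⟩)
    refine (ModuleCat.isZero_iff_subsingleton).2 (subsingleton_of_forall_eq 0 fun y => ?_)
    obtain ⟨x, hx⟩ := hsurj Y a hP (e'.symm (y, 0))
    have hx' : x ∈ LinearMap.ker a := by
      rw [heq, LinearMap.mem_ker]
      simp [hx]
    rw [LinearMap.mem_ker.1 hx'] at hx
    simpa using congrArg (fun z => (e' z).1) hx.symm

/-- A section of the sum writes `1` as `p s₁ + q s₂` in a local ring. One summand is then a unit,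
and its inverse turns `s₁` or `s₂` into a section. -/
theorem not_split_coprod (M : ModuleCat.{u} R) [IsLocalRing (Module.End R M)]
    {E E' : Type u} [AddCommGroup E] [Module R E] [AddCommGroup E'] [Module R E']
    (p : E →ₗ[R] M) (q : E' →ₗ[R] M) (hp : ¬ ∃ s : M →ₗ[R] E, p ∘ₗ s = LinearMap.id)
    (hq : ¬ ∃ s : M →ₗ[R] E', q ∘ₗ s = LinearMap.id) :
    ¬ ∃ s : M →ₗ[R] (E × E'), p.coprod q ∘ₗ s = LinearMap.id := by
  rintro ⟨s, hs⟩
  let s₁ : M →ₗ[R] E := LinearMap.fst R _ _ ∘ₗ s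
  let s₂ : M →ₗ[R] E' := LinearMap.snd R _ _ ∘ₗ s
  have h1 : p ∘ₗ s₁ + q ∘ₗ s₂ = (1 : Module.End R M) := by
    ext x
    exact LinearMap.congr_fun hs x
  rcases IsLocalRing.isUnit_or_isUnit_of_add_one h1 with h | h
  · obtain ⟨v, hv⟩ := h.exists_right_inv
    exact hp ⟨s₁ ∘ₗ v, hv⟩
  · obtain ⟨v, hv⟩ := h.exists_right_inv
    exact hq ⟨s₂ ∘ₗ v, hv⟩

/-- The section gives `N ≅ ker q ⊕ M`; since `M` is nonzero, the kernel is zero. -/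
theorem nonempty_iso_of_isSplitEpi {C : Type*} [Category* C] [Abelian C] {N M : C}
    (hN : Indecomposable N) (hM : ¬ IsZero M) (q : N ⟶ M) [IsSplitEpi q] :
    Nonempty (N ≅ M) := by
  let S : ShortComplex C := ShortComplex.mk (kernel.ι q) q (kernel.condition q)
  let σ : S.Splitting := ShortComplex.Splitting.ofExactOfSection S
    (ShortComplex.exact_of_f_is_kernel _ (kernelIsKernel q)) (section_ q) (by simp [S])
    (inferInstanceAs (Mono (kernel.ι q)))
  have h := (hN.2 _ _ σ.isoBinaryBiproduct).resolve_right hM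
  have : Mono q := Preadditive.mono_of_kernel_zero (h.eq_of_src _ _)
  have : IsIso q := isIso_of_mono_of_isSplitEpi q
  exact ⟨asIso q⟩

end

/-! ### Direct summands and pushouts of MCM modules. -/

section
variable {R : Type u} [CommRing R] [IsLocalRing R]

/-- By functoriality, the identity of `Ext^n(k, Y)` factors through `Ext^n(k, L)`, which is zero. -/
theorem isMCM_of_retract {Y L : ModuleCat.{u} R} (i : Y →ₗ[R] L) (a : L →ₗ[R] Y)
    (h : a ∘ₗ i = LinearMap.id) (hL : IsMCM R L) : IsMCM R Y := by
  refine ⟨?_, fun n hn => ?_⟩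
  · have := hL.1
    exact Module.Finite.of_surjective a fun y => ⟨i y, LinearMap.congr_fun h y⟩
  · have := hL.2 n hn
    suffices key : ∀ z : Abelian.Ext (ModuleCat.of R (ResidueField R)) Y n, z = 0 from
      ⟨fun x y => by rw [key x, key y]⟩
    intro z
    have h1 : z.comp (Abelian.Ext.mk₀ (ModuleCat.ofHom i)) (add_zero n) = 0 :=
      Subsingleton.elim _ _
    have h2 := congrArg (fun w => w.comp (Abelian.Ext.mk₀ (ModuleCat.ofHom a)) (add_zero n)) h1
    have h3 : ModuleCat.ofHom i ≫ ModuleCat.ofHom a = 𝟙 Y := by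
      rw [← ModuleCat.ofHom_comp, h]
      rfl
    simpa [h3] using h2

theorem isMCM_fst {Y Y₁ Y₂ : ModuleCat.{u} R} (e : Y ≃ₗ[R] (Y₁ × Y₂)) (hY : IsMCM R Y) :
    IsMCM R Y₁ :=
  isMCM_of_retract (e.symm.toLinearMap ∘ₗ LinearMap.inl R Y₁ Y₂)
    (LinearMap.fst R Y₁ Y₂ ∘ₗ e.toLinearMap) (by ext; simp) hY

theorem isMCM_snd {Y Y₁ Y₂ : ModuleCat.{u} R} (e : Y ≃ₗ[R] (Y₁ × Y₂)) (hY : IsMCM R Y) :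
    IsMCM R Y₂ :=
  isMCM_of_retract (e.symm.toLinearMap ∘ₗ LinearMap.inr R Y₁ Y₂)
    (LinearMap.snd R Y₁ Y₂ ∘ₗ e.toLinearMap) (by ext; simp) hY

/-- A map that does not lift along `p` does not lift on some indecomposable direct summand. -/
theorem exists_indecomposable_summand_not_lift [IsNoetherianRing R] {L E M : ModuleCat.{u} R}
    (hL : IsMCM R L) (q : L →ₗ[R] M) (p : E →ₗ[R] M) (hq : ¬ ∃ h : L →ₗ[R] E, p ∘ₗ h = q) :
    ∃ (Y : ModuleCat.{u} R) (i : Y →ₗ[R] L), IsMCM R Y ∧ Indecomposable Y ∧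
      ¬ ∃ h : Y →ₗ[R] E, p ∘ₗ h = q ∘ₗ i := by
  have := hL.1
  obtain ⟨Y, a, ⟨hY, i, -, hi⟩, hind⟩ := exists_indecomposable_quotient L
    -- Carrying the section `i` along makes each quotient a direct summand of `L`.
    (fun Y a => IsMCM R Y ∧ ∃ i : Y →ₗ[R] L, a ∘ₗ i = LinearMap.id ∧
      ¬ ∃ h : Y →ₗ[R] E, p ∘ₗ h = q ∘ₗ i)
    ⟨hL, LinearMap.id, rfl, hq⟩
    (fun Y a ⟨_, i, hi, _⟩ y => ⟨i y, LinearMap.congr_fun hi y⟩)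
    (fun Y a ⟨_, i, _, hi⟩ hs => hi ⟨0, by ext y; simp [Subsingleton.elim y 0]⟩)
    (by
      rintro Y a ⟨hY, i, hai, hi⟩ Y₁ Y₂ e
      have hai' : ∀ y, a (i y) = y := LinearMap.congr_fun hai
      by_contra! hcon
      have h1 := hcon.1 (isMCM_fst e hY) (i ∘ₗ e.symm.toLinearMap ∘ₗ LinearMap.inl R Y₁ Y₂)
        (by ext; simp [hai'])
      have h2 := hcon.2 (isMCM_snd e hY) (i ∘ₗ e.symm.toLinearMap ∘ₗ LinearMap.inr R Y₁ Y₂)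
        (by ext; simp [hai'])
      obtain ⟨l₁, hl₁⟩ := h1
      obtain ⟨l₂, hl₂⟩ := h2
      -- Lifts on both summands would add up to a lift on `Y`.
      refine hi ⟨l₁.coprod l₂ ∘ₗ e.toLinearMap, ?_⟩
      ext y
      have e1 := LinearMap.congr_fun hl₁ (e y).1
      have e2 := LinearMap.congr_fun hl₂ (e y).2
      simp only [LinearMap.comp_apply] at e1 e2
      simp only [LinearMap.comp_apply, LinearMap.coprod_apply, map_add]
      rw [LinearEquiv.coe_coe, e1, e2, ← map_add, ← map_add, ← map_add]
      simp)
  exact ⟨Y, i, hY, hind, hi⟩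

/-- If the identity of `N` does not extend along `ι : N → E`, then neither does some map from `N`
to an indecomposable maximal Cohen-Macaulay module. -/
theorem exists_indecomposable_quotient_not_extend [IsNoetherianRing R] {N E : ModuleCat.{u} R}
    (hN : IsMCM R N) (ι : N →ₗ[R] E) (hι : ¬ ∃ r : E →ₗ[R] N, r ∘ₗ ι = LinearMap.id) :
    ∃ (Z : ModuleCat.{u} R) (π : N →ₗ[R] Z), IsMCM R Z ∧ Indecomposable Z ∧
      ¬ ∃ r : E →ₗ[R] Z, r ∘ₗ ι = π := by
  have := hN.1
  obtain ⟨Z, π, ⟨hZ, -, hi⟩, hind⟩ := exists_indecomposable_quotient N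
    (fun Z π => IsMCM R Z ∧ Function.Surjective π ∧ ¬ ∃ r : E →ₗ[R] Z, r ∘ₗ ι = π)
    ⟨hN, Function.surjective_id, hι⟩
    (fun Z π h => h.2.1)
    (fun Z π h hs => h.2.2 ⟨0, by ext y; exact Subsingleton.elim _ _⟩)
    (by
      rintro Z π ⟨hZ, hs, hi⟩ Z₁ Z₂ e
      by_contra! hcon
      obtain ⟨r₁, hr₁⟩ := hcon.1 (isMCM_fst e hZ)
        (Prod.fst_surjective.comp (e.surjective.comp hs))
      obtain ⟨r₂, hr₂⟩ := hcon.2 (isMCM_snd e hZ)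
        (Prod.snd_surjective.comp (e.surjective.comp hs))
      refine hi ⟨e.symm.toLinearMap ∘ₗ r₁.prod r₂, ?_⟩
      ext y
      have e1 : r₁ (ι y) = (e (π y)).1 := LinearMap.congr_fun hr₁ y
      have e2 : r₂ (ι y) = (e (π y)).2 := LinearMap.congr_fun hr₂ y
      simp [e1, e2])
  exact ⟨Z, π, hZ, hind, hi⟩

/-- A non-split extension of maximal Cohen-Macaulay modules maps to a non-split extension of the
same module by an indecomposable one. -/
theorem exists_nonsplit_indecomposable_kernel [IsNoetherianRing R] {E M : ModuleCat.{u} R}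
    (hE : IsMCM R E) (hM : IsMCM R M) (p : E →ₗ[R] M) (hp : Function.Surjective p)
    (hsplit : ¬ ∃ s : M →ₗ[R] E, p ∘ₗ s = LinearMap.id) :
    ∃ (Z E' : ModuleCat.{u} R) (f : Z ⟶ E') (g : E' ⟶ M) (w : f ≫ g = 0) (c : E →ₗ[R] E'),
      (ShortComplex.mk f g w).ShortExact ∧ IsMCM R Z ∧ IsMCM R E' ∧ Indecomposable Z ∧
      IsEmpty (ShortComplex.mk f g w).Splitting ∧ g.hom ∘ₗ c = p := by
  -- A retraction onto `ker p` would be equivalent to a section of `p`.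
  obtain ⟨Z, π, hZ, hind, hπ⟩ := exists_indecomposable_quotient_not_extend
    (isMCM_ker p hp hE hM) (E := E) (LinearMap.ker p).subtype fun hr =>
      hsplit (((LinearMap.exact_subtype_ker_map p).split_tfae (Submodule.subtype_injective _)
        hp).out 1 0 |>.1 hr)
  -- The cokernel of `d` is the pushout of the inclusion `ker p → E` along `π`.
  let d : LinearMap.ker p →ₗ[R] (Z × E) := π.prod (-(LinearMap.ker p).subtype)
  let f : Z →ₗ[R] ((Z × E) ⧸ LinearMap.range d) := (LinearMap.range d).mkQ ∘ₗ LinearMap.inl R Z E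
  let c : E →ₗ[R] ((Z × E) ⧸ LinearMap.range d) := (LinearMap.range d).mkQ ∘ₗ LinearMap.inr R Z E
  let g : ((Z × E) ⧸ LinearMap.range d) →ₗ[R] M :=
    (LinearMap.range d).liftQ (p ∘ₗ LinearMap.snd R Z E) (by
      rintro _ ⟨n, rfl⟩
      simp [d])
  have hf : Function.Injective f := by
    rw [← LinearMap.ker_eq_bot, LinearMap.ker_eq_bot']
    intro z hz
    obtain ⟨n, hn⟩ := (Submodule.Quotient.mk_eq_zero _).1 hz
    obtain ⟨h1, h2⟩ := Prod.ext_iff.1 hn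
    have hn0 : n = 0 := by simpa [d] using h2
    rw [hn0] at h1
    simpa using h1.symm
  have hgc : g ∘ₗ c = p := by
    ext x
    simp [g, c]
  have hfc : ∀ n : LinearMap.ker p, f (π n) = c n := fun n => by
    refine (Submodule.Quotient.eq _).2 ⟨n, ?_⟩
    simp [d]
  have hfg : Function.Exact f g := by
    intro y
    constructor
    · obtain ⟨⟨z, x⟩, rfl⟩ := Submodule.Quotient.mk_surjective _ y
      intro hx
      have hx' : x ∈ LinearMap.ker p := by simpa [g] using hx
      refine ⟨z + π ⟨x, hx'⟩, ?_⟩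
      rw [map_add, hfc]
      change Submodule.Quotient.mk ((z, 0) + (0, x)) = _
      simp
    · rintro ⟨z, rfl⟩
      simp [g, f]
  have hg : Function.Surjective g := fun m => by
    obtain ⟨x, rfl⟩ := hp m
    exact ⟨c x, LinearMap.congr_fun hgc x⟩
  have w : ModuleCat.ofHom f ≫ ModuleCat.ofHom g = 0 := by
    ext x
    exact hfg.apply_apply_eq_zero x
  have hS : (ShortComplex.mk (ModuleCat.ofHom f) (ModuleCat.ofHom g) w).ShortExact :=
    ModuleCat.shortComplex_shortExact _ hfg hf hg
  -- A retraction of `f` composed with `c` would extend `π` to `E`.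
  refine ⟨Z, _, ModuleCat.ofHom f, ModuleCat.ofHom g, w, c, hS, hZ, isMCM_X₂ hS hZ hM, hind,
    ⟨fun σ => hπ ⟨σ.r.hom ∘ₗ c, ?_⟩⟩, hgc⟩
  ext n
  have h1 : σ.r.hom (f (π n)) = π n := congrArg (fun k => ModuleCat.Hom.hom k (π n)) σ.f_r
  rw [← h1, hfc]
  rfl

/-! ### Right almost split maps at an isolated point. -/

/-- There is a surjection from a maximal Cohen-Macaulay module to `M` that is not split and along
which all maps lift from indecomposable modules other than `M` and all non-surjective
endomorphisms of `M`. -/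
theorem exists_lift_indecomposable [IsNoetherianRing R] [IsCohenMacaulay R]
    [IsAdicComplete (maximalIdeal R) R] (M : IndecCM R)
    (h : Sp.mk M ∉ gamma (sigma {Sp.mk M}ᶜ)) :
    ∃ (E : ModuleCat.{u} R) (p : E →ₗ[R] M.1.obj), IsMCM R E ∧ Function.Surjective p ∧
      (¬ ∃ s : M.1.obj →ₗ[R] E, p ∘ₗ s = LinearMap.id) ∧
      (∀ N : IndecCM R, Sp.mk N ≠ Sp.mk M → ∀ q : N.1.obj →ₗ[R] M.1.obj,
        ∃ l : N.1.obj →ₗ[R] E, p ∘ₗ l = q) ∧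
      ∀ r : Module.End R M.1.obj, ¬ Function.Surjective r →
        ∃ l : M.1.obj →ₗ[R] E, p ∘ₗ l = r := by
  have := isLocalRing_end_indec M
  have := M.1.property.1
  -- The endomorphisms of `M` that lift along `p` form a submodule of the Noetherian module `End M`;
  -- choose `p` with this submodule maximal.
  obtain ⟨_, ⟨E, p, hE, hsurj, hsplit, hN, rfl⟩, hmax⟩ := set_has_maximal_iff_noetherian.2
    (inferInstanceAs (IsNoetherian R (Module.End R M.1.obj)))
    {I | ∃ (E : ModuleCat.{u} R) (p : E →ₗ[R] M.1.obj), IsMCM R E ∧ Function.Surjective p ∧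
      (¬ ∃ s : M.1.obj →ₗ[R] E, p ∘ₗ s = LinearMap.id) ∧
      (∀ N : IndecCM R, Sp.mk N ≠ Sp.mk M → ∀ q : N.1.obj →ₗ[R] M.1.obj,
        ∃ l : N.1.obj →ₗ[R] E, p ∘ₗ l = q) ∧
      LinearMap.range (LinearMap.compRight R (M := M.1.obj) p) = I} (by
    -- The family is nonempty: add a free cover `θ` of `M` to the map provided by the closure
    -- condition.
    obtain ⟨K, p, hp, hpM⟩ := exists_map_of_notMem_closure _ M h
    obtain ⟨n, θ, hθ⟩ := Module.Finite.exists_fin' R M.1.obj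
    refine ⟨_, ModuleCat.of R (K.obj × (Fin n → R)), p.hom.hom.coprod θ,
      isMCM_prod _ _ K.property (isMCM_pi n), fun x => ?_, ?_, fun N hNM q => ?_, rfl⟩
    · obtain ⟨y, rfl⟩ := hθ x
      exact ⟨(0, y), by simp⟩
    · refine not_split_coprod M.1.obj _ _ ?_ ?_
      · rintro ⟨s, hs⟩
        apply hpM (ObjectProperty.homMk (ModuleCat.ofHom s))
        ext x
        exact LinearMap.congr_fun hs x
      · rintro ⟨s, hs⟩
        have : Module.Finite R (ModuleCat.of R (Fin n → R)) :=
          inferInstanceAs (Module.Finite R (Fin n → R))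
        have : Module.Free R (ModuleCat.of R (Fin n → R)) :=
          inferInstanceAs (Module.Free R (Fin n → R))
        apply not_retract_of_free M (ModuleCat.of R (Fin n → R)) (ModuleCat.ofHom s)
          (ModuleCat.ofHom θ)
        ext x
        exact LinearMap.congr_fun hs x
    · obtain ⟨u, hu⟩ := hp N hNM (ObjectProperty.homMk (ModuleCat.ofHom q))
      refine ⟨LinearMap.inl R _ _ ∘ₗ u.hom.hom, ?_⟩
      ext x
      simpa using congrArg (fun g => ModuleCat.Hom.hom g.hom x) hu)
  refine ⟨E, p, hE, hsurj, hsplit, hN, fun r hr => ?_⟩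
  -- Adjoining `r` stays inside the family, and `r` lifts along `p'` through the second factor. By
  -- maximality it already lifts along `p`.
  let p' : (E × M.1.obj) →ₗ[R] M.1.obj := p.coprod r
  have hle : LinearMap.range (LinearMap.compRight R (M := M.1.obj) p) ≤
      LinearMap.range (LinearMap.compRight R (M := M.1.obj) p') := by
    rintro _ ⟨l, rfl⟩
    refine ⟨LinearMap.inl R _ _ ∘ₗ l, ?_⟩
    ext x
    simp [p']
  have heq := eq_of_le_of_not_lt hle (hmax _ ⟨ModuleCat.of R (E × M.1.obj), p',
    isMCM_prod _ _ hE M.1.property, fun x => ?_, not_split_coprod M.1.obj p r hsplit ?_,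
    fun N hNM q => ?_, rfl⟩)
  · have : r ∈ LinearMap.range (LinearMap.compRight R (M := M.1.obj) p) := by
      rw [heq]
      refine ⟨LinearMap.inr R _ _, ?_⟩
      ext x
      simp [p']
    exact this
  · obtain ⟨y, rfl⟩ := hsurj x
    exact ⟨(y, 0), by simp [p']⟩
  · rintro ⟨s, hs⟩
    exact hr fun x => ⟨s x, LinearMap.congr_fun hs x⟩
  · obtain ⟨l, rfl⟩ := hN N hNM q
    refine ⟨LinearMap.inl R _ _ ∘ₗ l, ?_⟩
    ext x
    simp [p']

/-- If `M` is not in the closure of the other points, then there is a surjection onto `M` that is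
right almost split in the category of maximal Cohen-Macaulay modules. -/
theorem exists_rightAlmostSplit [IsNoetherianRing R] [IsCohenMacaulay R]
    [IsAdicComplete (maximalIdeal R) R] (M : IndecCM R)
    (h : Sp.mk M ∉ gamma (sigma {Sp.mk M}ᶜ)) :
    ∃ (E : ModuleCat.{u} R) (p : E →ₗ[R] M.1.obj), IsMCM R E ∧ Function.Surjective p ∧
      (¬ ∃ s : M.1.obj →ₗ[R] E, p ∘ₗ s = LinearMap.id) ∧
      ∀ (L : ModuleCat.{u} R) (q : L ⟶ M.1.obj), IsMCM R L → ¬ IsSplitEpi q →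
        ∃ l : L →ₗ[R] E, p ∘ₗ l = q.hom := by
  have := M.1.property.1
  obtain ⟨E, p, hE, hsurj, hsplit, hN, hM⟩ := exists_lift_indecomposable M h
  refine ⟨E, p, hE, hsurj, hsplit, fun L q hL hq => ?_⟩
  by_contra hl
  obtain ⟨Y, i, hY, hind, hi⟩ := exists_indecomposable_summand_not_lift hL q.hom p hl
  -- Three cases for the bad summand: `R` is projective, modules other than `M` lift by
  -- construction, and for `M` itself surjectivity of the induced endomorphism decides.
  by_cases hR : Nonempty (Y ≅ ModuleCat.of R R)
  · obtain ⟨e⟩ := hR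
    have : Module.Projective R Y := Module.Projective.of_equiv e.toLinearEquiv.symm
    exact hi (Module.projective_lifting_property p _ hsurj)
  let N : IndecCM R := ⟨⟨Y, hY⟩, hind, not_nonempty_iff.1 hR⟩
  by_cases hNM : Sp.mk N = Sp.mk M
  · obtain ⟨e⟩ := Quotient.exact hNM
    let e' : Y ≃ₗ[R] M.1.obj := e.toLinearEquiv
    let r : Module.End R M.1.obj := q.hom ∘ₗ i ∘ₗ e'.symm.toLinearMap
    by_cases hr : Function.Surjective r
    -- A surjective endomorphism of a finite module is bijective, so its inverse yields a section of
    -- `q`.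
    · have hbij : Function.Bijective r :=
        ⟨OrzechProperty.injective_of_surjective_endomorphism r hr, hr⟩
      let ρ := LinearEquiv.ofBijective r hbij
      refine hq ⟨⟨⟨ModuleCat.ofHom (i ∘ₗ e'.symm.toLinearMap ∘ₗ ρ.symm.toLinearMap), ?_⟩⟩⟩
      ext x
      exact ρ.apply_symm_apply x
    · obtain ⟨l, hl⟩ := hM r hr
      refine hi ⟨l ∘ₗ e'.toLinearMap, ?_⟩
      ext y
      have := LinearMap.congr_fun hl (e' y)
      simpa [r] using this
  · exact hi (hN N hNM _)

/-- The closure of the complement of `x` can gain no point other than `x`. -/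
theorem isOpen_singleton_iff_notMem_closure [IsNoetherianRing R] [IsCohenMacaulay R]
    [IsAdicComplete (maximalIdeal R) R] (x : Sp R) :
    IsOpen {x} ↔ x ∉ gamma (sigma {x}ᶜ) := by
  rw [← isClosed_compl_iff, isClosed_iff]
  refine ⟨fun h => by simp [h], fun h => Set.Subset.antisymm (fun y hy => ?_) (subset_closure _)⟩
  rintro rfl
  exact h hy

end
end MCM

/-! ### Isolated points and Auslander-Reiten sequences. -/

theorem proposition2p14 {R : Type u} [CommRing R] [IsNoetherianRing R] [IsLocalRing R]
    [IsAdicComplete (IsLocalRing.maximalIdeal R) R] [MCM.IsCohenMacaulay R] (M : MCM.IndecCM R) :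
    IsOpen ({MCM.Sp.mk M} : Set (MCM.Sp R)) ↔
      ∃ S : CategoryTheory.ShortComplex (ModuleCat.{u} R),
        MCM.IsARSequence S ∧ Nonempty (S.X₃ ≅ M.toCM.obj) := by
  rw [MCM.isOpen_singleton_iff_notMem_closure]
  constructor
  · intro h
    obtain ⟨E, p, hE, hsurj, hsplit, hlift⟩ := MCM.exists_rightAlmostSplit M h
    obtain ⟨Z, E', f, g, w, c, hS, hZ, hE', hind, hns, hgc⟩ :=
      MCM.exists_nonsplit_indecomposable_kernel hE M.1.property p hsurj hsplit
    refine ⟨ShortComplex.mk f g w, ⟨hZ, hE', M.1.property, hind, M.2, hS, hns,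
      fun L q hL hq => ?_⟩, ⟨Iso.refl _⟩⟩
    obtain ⟨l, hl⟩ := hlift L q hL hq
    -- Lifts survive the pushout because `g ∘ c = p`.
    refine ⟨ModuleCat.ofHom (c ∘ₗ l), ?_⟩
    ext x
    rw [← hl, ← hgc]
    rfl
  · rintro ⟨S, hS, ⟨e⟩⟩
    let p : (⟨S.X₂, hS.isMCM₂⟩ : MCM.CM R) ⟶ M.1 := ObjectProperty.homMk (S.g ≫ e.hom)
    refine MCM.notMem_closure_of_map _ M _ p (fun N hN h => ?_) fun u hu => ?_
    -- A split epimorphism from the indecomposable `N` would force `N ≅ M`, but `N` lies in the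
    -- complement of `M`.
    · obtain ⟨l, hl⟩ := hS.exists_lift N.1.obj (h.hom ≫ e.inv) N.1.property fun hsplit => by
        obtain ⟨i⟩ := MCM.nonempty_iso_of_isSplitEpi N.2 hS.indecomposable₃.1 (h.hom ≫ e.inv)
        exact hN (Quotient.sound ⟨i ≪≫ e⟩)
      refine ⟨ObjectProperty.homMk l, ?_⟩
      ext1
      change l ≫ S.g ≫ e.hom = h.hom
      rw [reassoc_of% hl, e.inv_hom_id, Category.comp_id]
    -- A section of `p`, transported along `e`, would split the sequence.
    · have hu' : u.hom ≫ S.g ≫ e.hom = 𝟙 _ := congrArg (fun k => k.hom) hu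
      refine hS.nonsplit.false (ShortComplex.Splitting.ofExactOfSection S hS.shortExact.exact
        (e.hom ≫ u.hom) ?_ hS.shortExact.mono_f)
      rw [← cancel_mono e.hom]
      simp [hu']
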